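/- A finite stochastic game $\mathcal G$ consists of a finite directed graph $(V,E)$ in which every vertex has an out-neighbour, a partition of $V$ into vertices of Player 1, vertices of Player 2 and probabilistic vertices, for every probabilistic vertex a probability distribution whose support is exactly the set of its out-neighbours, and a payoff function $w\colon E\to\mathbb Q$. A play is an infinite path $\pi=v_0v_1v_2\cdots$ of $(V,E)$, and a strategy of a player is a (deterministic) function that maps every finite path ending in one of his or her vertices to an out-neighbour of that vertex. For $\ell\ge 1$, let $$\mathrm{FWMP}(\ell)=\Big\{\pi \text{ a play} : \exists k\ge 0\ \forall i\ge k\ \exists j\in\{1,\dots,\ell\}:\ \tfrac1j\sum_{m=i}^{i+j-1}w(v_m,v_{m+1})\ge 0\Big\},\qquad \mathrm{BWMP}=\bigcup_{\ell\ge 1}\mathrm{FWMP}(\ell),$$ and let $\overline{\mathrm{BWMP}}$ be the complement of $\mathrm{BWMP}$ in the set of plays. The adversarial game of $\mathcal G$ is the non-stochastic game obtained from $\mathcal G$ by giving all probabilistic vertices to Player 2. **Lemma.** For every finite stochastic game $\mathcal G$, the objective $\mathrm{BWMP}$ has the sure-almost-sure (SAS) property. That is, $\mathrm{BWMP}$ is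 a Borel set of plays; it is prefix-independent (every suffix of a play in $\mathrm{BWMP}$ is in $\mathrm{BWMP}$, and every play that has a suffix in $\mathrm{BWMP}$ is in $\mathrm{BWMP}$); and the following holds. Suppose that from every vertex $v$ Player 2 has a strategy in the adversarial game such that every play from $v$ consistent with it is in $\overline{\mathrm{BWMP}}$. Then from every vertex $v$ Player 2 has a strategy $\tau$ in $\mathcal G$ such that, for every strategy $\sigma$ of Player 1 in $\mathcal G$, the outcome of $(\sigma,\tau)$ from $v$ is in $\overline{\mathrm{BWMP}}$ with probability $1$. -/

import Mathlib

open MeasureTheory ProbabilityTheory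

/-- The two players. -/
inductive Player
  | main
  | adversary

/-- The possible owners of a vertex: a player, or nobody (a probabilistic vertex). -/
inductive Owner
  | player (i : Player)
  | random

/-- A two-player turn-based stochastic game on the vertex set `V`: a directed graph without
deadlocks whose vertices are partitioned by `owner`, a probability distribution for every
probabilistic vertex whose support is exactly the set of out-neighbours of that vertex, and
rational payoffs on the edges (the value of `payoff` at a pair that is not an edge plays no
role). -/
structure StochasticGame (V : Type*) where
  edge : V → V → Prop
  no_deadlock : ∀ v, ∃ v', edge v v'
  owner : V → Owner
  prob : {v : V // owner v = Owner.random} → PMF V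
  mem_support_prob : ∀ v v', v' ∈ (prob v).support ↔ edge v v'
  payoff : V → V → ℚ

namespace StochasticGame

variable {V : Type*}

/-- Finite sequences `v₀ v₁ … vₙ` of vertices. -/
abbrev History (V : Type*) (n : ℕ) : Type _ := Finset.Iic n → V

/-- The `k`-th vertex of `v₀ v₁ … vₙ`, for `k ≤ n`. -/
def History.get {n : ℕ} (h : History V n) (k : ℕ) (hk : k ≤ n) : V :=
  h ⟨k, Finset.mem_Iic.2 hk⟩

/-- The last vertex of `v₀ v₁ … vₙ`. -/
def History.last {n : ℕ} (h : History V n) : V := h.get n le_rfl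

/-- The finite sequence `π(0) π(1) … π(n)`. -/
def historyOf (π : ℕ → V) (n : ℕ) : History V n := fun k => π k

/-- The suffix `π(j) π(j+1) …`. -/
def suffixOf (π : ℕ → V) (j : ℕ) : ℕ → V := fun i => π (j + i)

variable (G : StochasticGame V)

/-- The set of all plays of the game. -/
def plays : Set (ℕ → V) := {π | ∀ i, G.edge (π i) (π (i + 1))}

/-- The finite sequence is a prefix in the game, that is, a finite path. -/
def IsPrefix {n : ℕ} (h : History V n) : Prop :=
  ∀ k (hk : k < n), G.edge (h.get k hk.le) (h.get (k + 1) hk)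

/-- A (deterministic) strategy of player `i`: it maps every prefix that ends in a vertex of
player `i` to an out-neighbour of that vertex. The values of `next` at all other sequences
are irrelevant. -/
structure Strategy (i : Player) where
  next : (n : ℕ) → History V n → V
  edge_next : ∀ n (h : History V n), G.IsPrefix h → G.owner h.last = Owner.player i →
    G.edge h.last (next n h)

variable {G}

/-- The play `π` is consistent with the strategy `σ` of player `i`. -/
def Strategy.Consistent {i : Player} (σ : G.Strategy i) (π : ℕ → V) : Prop :=
  ∀ j, G.owner (π j) = Owner.player i → π (j + 1) = σ.next j (historyOf π j)

variable (G)

/-- The vertices from which player `i` surely wins the objective `Φ`: some strategy of player `i`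
is such that every play from the vertex consistent with it satisfies `Φ`. -/
def sureRegion (i : Player) (Φ : Set (ℕ → V)) : Set V :=
  {v | ∃ σ : G.Strategy i, ∀ π ∈ G.plays, π 0 = v → σ.Consistent π → π ∈ Φ}

/-- The adversarial game: all probabilistic vertices are given to the adversary. -/
def adversarial : StochasticGame V where
  edge := G.edge
  no_deadlock := G.no_deadlock
  owner v :=
    match G.owner v with
    | Owner.player i => Owner.player i
    | Owner.random => Owner.player Player.adversary
  prob v := absurd v.2 (by cases G.owner v.1 <;> simp)
  mem_support_prob v := absurd v.2 (by cases G.owner v.1 <;> simp)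
  payoff := G.payoff

variable {G}

/-- The distribution of the next vertex after the history `h`, given the strategies of both
players. -/
noncomputable def nextDist (σ : G.Strategy Player.main) (τ : G.Strategy Player.adversary)
    {n : ℕ} (h : History V n) : PMF V :=
  match hv : G.owner h.last with
  | Owner.player Player.main => PMF.pure (σ.next n h)
  | Owner.player Player.adversary => PMF.pure (τ.next n h)
  | Owner.random => G.prob ⟨h.last, hv⟩

section Probability

variable [Finite V] [MeasurableSpace V] [DiscreteMeasurableSpace V]

/-- The Markov kernel from histories of length `n` to the next vertex. -/
noncomputable def stepKernel (σ : G.Strategy Player.main) (τ : G.Strategy Player.adversary)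
    (n : ℕ) : Kernel (History V n) V :=
  Kernel.ofFunOfCountable fun h => (nextDist σ τ h).toMeasure

instance (σ : G.Strategy Player.main) (τ : G.Strategy Player.adversary) (n : ℕ) :
    IsMarkovKernel (stepKernel σ τ n) :=
  ⟨fun h => PMF.toMeasure.isProbabilityMeasure (nextDist σ τ h)⟩

/-- The law, on infinite sequences of vertices, of the outcome of the strategy profile `(σ, τ)`
from the initial vertex `v` (the measure given by the theorem of Ionescu-Tulcea). -/
noncomputable def outcomeMeasure (σ : G.Strategy Player.main) (τ : G.Strategy Player.adversary)
    (v : V) : Measure (ℕ → V) :=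
  Kernel.traj (X := fun _ => V) (stepKernel σ τ) 0 (fun _ => v)

variable (G)

/-- The vertices from which the adversary almost surely wins the objective `Φ`. -/
def adversaryAlmostSureRegion (Φ : Set (ℕ → V)) : Set V :=
  {v | ∃ τ : G.Strategy Player.adversary, ∀ σ : G.Strategy Player.main,
    outcomeMeasure σ τ v Φ = 1}

/-- An objective is a measurable set of plays. -/
def IsObjective (Φ : Set (ℕ → V)) : Prop := Φ ⊆ G.plays ∧ MeasurableSet Φ

end Probability

variable (G)

/-- The complement of an objective within the set of plays. -/
def compl (Φ : Set (ℕ → V)) : Set (ℕ → V) := G.plays \ Φ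

/-- All suffixes of plays in `Φ` are in `Φ`. -/
def ClosedUnderSuffixes (Φ : Set (ℕ → V)) : Prop := ∀ π ∈ Φ, ∀ j, suffixOf π j ∈ Φ

/-- All plays that arise from a play in `Φ` by prepending finitely many vertices are in `Φ`. -/
def ClosedUnderPrefixes (Φ : Set (ℕ → V)) : Prop :=
  ∀ π ∈ G.plays, ∀ j, suffixOf π j ∈ Φ → π ∈ Φ

def PrefixIndependent (Φ : Set (ℕ → V)) : Prop :=
  G.ClosedUnderPrefixes Φ ∧ ClosedUnderSuffixes Φ

/-- `Φ` is a prefix-independent objective with the sure-almost-sure property: if the adversary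
surely wins the complement of `Φ` from every vertex of the adversarial game, then he almost surely
wins it from every vertex of the stochastic game. -/
structure SAS [Finite V] [MeasurableSpace V] [DiscreteMeasurableSpace V]
    (Φ : Set (ℕ → V)) : Prop where
  isObjective : G.IsObjective Φ
  prefixIndependent : G.PrefixIndependent Φ
  sure_almostSure :
    G.adversarial.sureRegion Player.adversary (G.adversarial.compl Φ) = Set.univ →
      G.adversaryAlmostSureRegion (G.compl Φ) = Set.univ

/-- The total payoff of the infix `π(i) π(i+1) … π(i+n)`. -/
def totalPayoff (π : ℕ → V) (i n : ℕ) : ℚ :=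
  ∑ k ∈ Finset.Ico i (i + n), G.payoff (π k) (π (k + 1))

/-- The mean payoff of the infix `π(i) π(i+1) … π(i+n)`, for `n ≥ 1`. -/
def meanPayoff (π : ℕ → V) (i n : ℕ) : ℚ := G.totalPayoff π i n / n

/-- The fixed window mean-payoff objective with window length `ℓ`. -/
def FWMP (ℓ : ℕ) : Set (ℕ → V) :=
  {π | π ∈ G.plays ∧ ∃ k, ∀ i ≥ k, ∃ j ∈ Finset.Icc 1 ℓ, 0 ≤ G.meanPayoff π i j}

/-- The bounded window mean-payoff objective. -/
def BWMP : Set (ℕ → V) := {π | π ∈ G.plays ∧ ∃ ℓ ≥ 1, π ∈ G.FWMP ℓ}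

end StochasticGame

/-! A play violates BWMP iff for all `ℓ ≥ 1` and `K` some window of length `ℓ` starting at or after
`K` stays open. By compactness, a surely winning adversarial strategy forces such a window within a
bounded time; as `V` is finite, one bound `N ℓ` serves all starting vertices
(`exists_uniform_not_mem_noOpenWindow`). In the stochastic game the adversary plays in phases. Each
phase restarts the sure strategy of the current vertex (hence the hypothesis at every vertex) and
targets one `ℓ`, each `ℓ` recurring infinitely often. Whatever the past, with probability at least
`p ^ N ℓ` chance imitates that strategy throughout the phase, where `p` bounds the positive
transition probabilities below, and then a window stays open (`mul_measure_le_of_restart`). So for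
given `ℓ` and `K` the absence of open windows has probability 0 (`ae_exists_not_mem_noOpenWindow`),
and there are only countably many such pairs. -/

namespace StochasticGame

open scoped ENNReal

/-! ### Open windows and prefix-independence -/

section Windows

variable {V : Type*} (G : StochasticGame V)

/-- The window of length `ℓ` that starts at position `i` stays open. -/
def OpenWindow (ℓ : ℕ) (π : ℕ → V) (i : ℕ) : Prop :=
  ∀ j ∈ Finset.Icc 1 ℓ, G.meanPayoff π i j < 0

/-- The finite path `π(0) … π(n)` contains no open window of length `ℓ` that starts at position
`K` or later. -/
def NoOpenWindow (ℓ K n : ℕ) : Set (ℕ → V) :=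
  {π | ∀ i, K ≤ i → i + ℓ ≤ n → ¬ G.OpenWindow ℓ π i}

variable {G}

theorem meanPayoff_suffixOf (π : ℕ → V) (j i n : ℕ) :
    G.meanPayoff (suffixOf π j) i n = G.meanPayoff π (j + i) n := by
  unfold meanPayoff totalPayoff suffixOf
  rw [add_comm j i, add_right_comm,
    ← Finset.sum_Ico_add (fun k => G.payoff (π k) (π (k + 1))) i (i + n) j]
  simp only [add_assoc]

theorem openWindow_suffixOf {ℓ : ℕ} {π : ℕ → V} {j i : ℕ} :
    G.OpenWindow ℓ (suffixOf π j) i ↔ G.OpenWindow ℓ π (j + i) := by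
  simp only [OpenWindow, meanPayoff_suffixOf]

theorem apply_eq_of_historyOf_eq {π ρ : ℕ → V} {n : ℕ} (h : historyOf π n = historyOf ρ n)
    {k : ℕ} (hk : k ≤ n) : π k = ρ k :=
  congrFun h ⟨k, Finset.mem_Iic.2 hk⟩

theorem historyOf_eq_iff {π ρ : ℕ → V} {n : ℕ} :
    historyOf π n = historyOf ρ n ↔ ∀ k ≤ n, π k = ρ k :=
  ⟨fun h _ hk => apply_eq_of_historyOf_eq h hk,
    fun h => funext fun k => h k (Finset.mem_Iic.1 k.2)⟩

theorem OpenWindow.congr {ℓ n i : ℕ} {π ρ : ℕ → V} (h : historyOf π n = historyOf ρ n)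
    (hi : i + ℓ ≤ n) (hπ : G.OpenWindow ℓ π i) : G.OpenWindow ℓ ρ i := by
  intro j hj
  have hj' := Finset.mem_Icc.1 hj
  have : G.meanPayoff ρ i j = G.meanPayoff π i j := by
    unfold meanPayoff totalPayoff
    congr 1
    refine Finset.sum_congr rfl fun k hk => ?_
    have hk' := Finset.mem_Ico.1 hk
    rw [apply_eq_of_historyOf_eq h (k := k) (by omega),
      apply_eq_of_historyOf_eq h (k := k + 1) (by omega)]
  rw [this]
  exact hπ j hj

theorem mem_noOpenWindow_congr {ℓ K n : ℕ} {π ρ : ℕ → V} (h : historyOf π n = historyOf ρ n) :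
    π ∈ G.NoOpenWindow ℓ K n ↔ ρ ∈ G.NoOpenWindow ℓ K n :=
  ⟨fun hπ i hK hi ho => hπ i hK hi (ho.congr h.symm hi),
    fun hρ i hK hi ho => hρ i hK hi (ho.congr h hi)⟩

theorem noOpenWindow_anti {ℓ K m n : ℕ} (h : m ≤ n) :
    G.NoOpenWindow ℓ K n ⊆ G.NoOpenWindow ℓ K m :=
  fun _ hπ i hK hi => hπ i hK (hi.trans h)

/-- Turns the complement into a countable intersection of unions of events decided by finite
prefixes, the form used for measurability, compactness and probability. -/
theorem mem_compl_BWMP_iff {π : ℕ → V} :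
    π ∈ G.compl G.BWMP ↔ π ∈ G.plays ∧ ∀ ℓ ≥ 1, ∀ K, ∃ n, π ∉ G.NoOpenWindow ℓ K n := by
  constructor
  · rintro ⟨hp, hn⟩
    refine ⟨hp, fun ℓ hℓ K => ?_⟩
    by_contra! hc
    refine hn ⟨hp, ℓ, hℓ, hp, K, fun i hi => ?_⟩
    have := hc (i + ℓ) i hi le_rfl
    unfold OpenWindow at this
    push Not at this
    exact this
  · rintro ⟨hp, h⟩
    refine ⟨hp, ?_⟩
    rintro ⟨-, ℓ, hℓ, -, K, hK⟩
    obtain ⟨n, hn⟩ := h ℓ hℓ K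
    refine hn fun i hi _ ho => ?_
    obtain ⟨j, hj, hj0⟩ := hK i hi
    exact absurd (ho j hj) (not_lt.2 hj0)

theorem suffixOf_mem_plays {π : ℕ → V} (h : π ∈ G.plays) (j : ℕ) : suffixOf π j ∈ G.plays :=
  fun i => h (j + i)

theorem prefixIndependent_BWMP : G.PrefixIndependent G.BWMP := by
  constructor
  · rintro π hπ j ⟨-, ℓ, hℓ, -, K, hK⟩
    refine ⟨hπ, ℓ, hℓ, hπ, j + K, fun i hi => ?_⟩
    obtain ⟨m, hm, h0⟩ := hK (i - j) (by omega)
    refine ⟨m, hm, ?_⟩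
    rwa [meanPayoff_suffixOf, Nat.add_sub_cancel' (by omega)] at h0
  · rintro π ⟨hp, ℓ, hℓ, -, K, hK⟩ j
    refine ⟨suffixOf_mem_plays hp j, ℓ, hℓ, suffixOf_mem_plays hp j, K, fun i hi => ?_⟩
    obtain ⟨m, hm, h0⟩ := hK (j + i) (by omega)
    exact ⟨m, hm, by rwa [meanPayoff_suffixOf]⟩

end Windows

/-! ### Borel measurability of the objective -/

section Measurability

theorem measurable_historyOf {V : Type*} [MeasurableSpace V] (n : ℕ) :
    Measurable fun π : ℕ → V => historyOf π n :=
  measurable_pi_lambda _ fun k => measurable_pi_apply (k : ℕ)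

variable {V : Type*} [Finite V] [MeasurableSpace V] [DiscreteMeasurableSpace V]

theorem measurableSet_of_historyOf {A : Set (ℕ → V)} (n : ℕ)
    (hA : ∀ π ρ, historyOf π n = historyOf ρ n → π ∈ A → ρ ∈ A) : MeasurableSet A := by
  have : A = (fun π => historyOf π n) ⁻¹' ((fun π => historyOf π n) '' A) := by
    ext π
    refine ⟨fun h => ⟨π, h, rfl⟩, ?_⟩
    rintro ⟨ρ, hρ, he⟩
    exact hA ρ π he hρ
  rw [this]
  exact measurable_historyOf n (Set.toFinite _).measurableSet

variable (G : StochasticGame V)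

theorem measurableSet_plays : MeasurableSet G.plays := by
  have : G.plays = ⋂ i, {π : ℕ → V | G.edge (π i) (π (i + 1))} := by
    ext π; simp [plays]
  rw [this]
  refine MeasurableSet.iInter fun i => measurableSet_of_historyOf (i + 1) fun π ρ h hπ => ?_
  rw [Set.mem_ofPred_eq] at hπ ⊢
  rwa [← apply_eq_of_historyOf_eq h (Nat.le_succ i), ← apply_eq_of_historyOf_eq h le_rfl]

theorem measurableSet_noOpenWindow (ℓ K n : ℕ) : MeasurableSet (G.NoOpenWindow ℓ K n) :=
  measurableSet_of_historyOf n fun _ _ h => (mem_noOpenWindow_congr h).1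

theorem measurableSet_BWMP : MeasurableSet G.BWMP := by
  have : G.BWMP = G.plays \ (G.plays ∩
      ⋂ ℓ : ℕ, ⋂ _ : ℓ ≥ 1, ⋂ K : ℕ, ⋃ n, (G.NoOpenWindow ℓ K n)ᶜ) := by
    have h : G.BWMP = G.plays \ G.compl G.BWMP := by
      unfold compl
      rw [Set.sdiff_sdiff_cancel_left]
      exact fun _ h => h.1
    rw [h]
    congr 1
    ext π
    rw [mem_compl_BWMP_iff]
    simp
  rw [this]
  refine G.measurableSet_plays.diff (G.measurableSet_plays.inter ?_)
  exact MeasurableSet.iInter fun ℓ => MeasurableSet.iInter fun _ => MeasurableSet.iInter fun K =>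
    MeasurableSet.iUnion fun n => (G.measurableSet_noOpenWindow ℓ K n).compl

end Measurability

/-! ### Compactness and bounded waiting times -/

section Compactness

variable {V : Type*}

/-- König's lemma: for discrete finite `V`, a set decided by a finite prefix is closed in the
compact space `ℕ → V`. -/
theorem exists_forall_mem_of_historyOf [Finite V] {C : ℕ → Set (ℕ → V)} (hanti : Antitone C)
    (hne : ∀ n, (C n).Nonempty)
    (hC : ∀ n π ρ, historyOf π n = historyOf ρ n → π ∈ C n → ρ ∈ C n) :
    ∃ π, ∀ n, π ∈ C n := by
  let _ : TopologicalSpace V := ⊥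
  have : DiscreteTopology V := ⟨rfl⟩
  have hcl : ∀ n, IsClosed (C n) := fun n => by
    have : C n = (fun π => historyOf π n) ⁻¹' ((fun π => historyOf π n) '' C n) := by
      ext π
      refine ⟨fun h => ⟨π, h, rfl⟩, ?_⟩
      rintro ⟨ρ, hρ, he⟩
      exact hC n ρ π he hρ
    rw [this]
    refine (isClosed_discrete _).preimage ?_
    exact continuous_pi fun k => continuous_apply (k : ℕ)
  obtain ⟨π, hπ⟩ := IsCompact.nonempty_iInter_of_sequence_nonempty_isCompact_isClosed C
    (fun n => hanti (Nat.le_succ n)) hne (hcl 0).isCompact hcl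
  exact ⟨π, Set.mem_iInter.1 hπ⟩

variable {G : StochasticGame V}

/-- The path `π(0) … π(n)` is a path of the game consistent with the strategy `σ`. -/
def Strategy.ConsistentUpTo {i : Player} (σ : G.Strategy i) (n : ℕ) (π : ℕ → V) : Prop :=
  ∀ j < n, G.edge (π j) (π (j + 1)) ∧
    (G.owner (π j) = Owner.player i → π (j + 1) = σ.next j (historyOf π j))

theorem historyOf_eq_of_le {π ρ : ℕ → V} {m n : ℕ} (h : historyOf π n = historyOf ρ n)
    (hm : m ≤ n) : historyOf π m = historyOf ρ m :=
  historyOf_eq_iff.2 fun _ hk => apply_eq_of_historyOf_eq h (hk.trans hm)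

theorem Strategy.ConsistentUpTo.congr {i : Player} {σ : G.Strategy i} {n : ℕ} {π ρ : ℕ → V}
    (h : historyOf π n = historyOf ρ n) (hπ : σ.ConsistentUpTo n π) : σ.ConsistentUpTo n ρ := by
  intro j hj
  have := hπ j hj
  rwa [apply_eq_of_historyOf_eq h (k := j) (by omega),
    apply_eq_of_historyOf_eq h (k := j + 1) (by omega),
    historyOf_eq_of_le h (m := j) (by omega)] at this

/-- Otherwise consistent paths of every length avoid open windows, and a limit of them is a
consistent play in BWMP. -/
theorem exists_not_mem_noOpenWindow [Finite V] {i : Player} {σ : G.Strategy i} {v : V}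
    (hσ : ∀ π ∈ G.plays, π 0 = v → σ.Consistent π → π ∈ G.compl G.BWMP) {ℓ : ℕ} (hℓ : 1 ≤ ℓ) :
    ∃ N, ∀ π : ℕ → V, π 0 = v → σ.ConsistentUpTo N π → π ∉ G.NoOpenWindow ℓ 0 N := by
  by_contra! hc
  obtain ⟨π, hπ⟩ := exists_forall_mem_of_historyOf
    (C := fun n => {π | π 0 = v ∧ σ.ConsistentUpTo n π ∧ π ∈ G.NoOpenWindow ℓ 0 n})
    (fun m n hmn π hπ =>
      ⟨hπ.1, fun j hj => hπ.2.1 j (hj.trans_le hmn), noOpenWindow_anti hmn hπ.2.2⟩)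
    hc
    (fun n π ρ h hπ => ⟨(apply_eq_of_historyOf_eq h (Nat.zero_le n)).symm.trans hπ.1,
      hπ.2.1.congr h, (mem_noOpenWindow_congr h).1 hπ.2.2⟩)
  have hplay : π ∈ G.plays := fun j => ((hπ (j + 1)).2.1 j (Nat.lt_succ_self j)).1
  have := hσ π hplay (hπ 0).1 fun j => ((hπ (j + 1)).2.1 j (Nat.lt_succ_self j)).2
  obtain ⟨n, hn⟩ := (mem_compl_BWMP_iff.1 this).2 ℓ hℓ 0
  exact hn (hπ n).2.2

end Compactness

/-! ### Support of the transition law -/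

section NextDist

variable {V : Type*} {G : StochasticGame V}

theorem edge_of_nextDist_ne_zero {σ : G.Strategy Player.main} {τ : G.Strategy Player.adversary}
    {n : ℕ} {h : History V n} (hh : G.IsPrefix h) {w : V} (hw : nextDist σ τ h w ≠ 0) :
    G.edge h.last w := by
  unfold nextDist at hw
  split at hw
  · rename_i ho
    rw [PMF.pure_apply] at hw
    have : w = σ.next n h := by by_contra hc; simp [hc] at hw
    exact this ▸ σ.edge_next n h hh ho
  · rename_i ho
    rw [PMF.pure_apply] at hw
    have : w = τ.next n h := by by_contra hc; simp [hc] at hw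
    exact this ▸ τ.edge_next n h hh ho
  · exact (G.mem_support_prob _ _).1 ((PMF.mem_support_iff _ _).2 hw)

end NextDist

/-! ### Cylinder probabilities -/

section Cylinders

variable {V : Type*} [Finite V] [MeasurableSpace V] [DiscreteMeasurableSpace V]
variable {G : StochasticGame V}

/-- The set of sequences that agree with `π` up to position `n`. -/
def cylinder (π : ℕ → V) (n : ℕ) : Set (ℕ → V) := {ρ | historyOf ρ n = historyOf π n}

instance (σ : G.Strategy Player.main) (τ : G.Strategy Player.adversary) (v : V) :
    IsProbabilityMeasure (outcomeMeasure σ τ v) := by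
  unfold outcomeMeasure; infer_instance

/-- By Ionescu-Tulcea, the joint law of the history and the next vertex is the history law composed
with the step kernel; evaluate it at one point. -/
theorem outcomeMeasure_cylinder_succ (σ : G.Strategy Player.main)
    (τ : G.Strategy Player.adversary) (v : V) (π : ℕ → V) (n : ℕ) :
    outcomeMeasure σ τ v (cylinder π (n + 1)) =
      nextDist σ τ (historyOf π n) (π (n + 1)) * outcomeMeasure σ τ v (cylinder π n) := by
  have key := Kernel.partialTraj_compProd_eq_map_traj (X := fun _ => V)
    (κ := stepKernel σ τ) (Nat.zero_le n) (x₀ := fun _ => v)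
  have hmap : Kernel.partialTraj (X := fun _ => V) (stepKernel σ τ) 0 n (fun _ => v) =
      (outcomeMeasure σ τ v).map (fun π => historyOf π n) := by
    unfold outcomeMeasure
    rw [← Kernel.traj_map_frestrictLe, Kernel.map_apply _ (by fun_prop)]
    rfl
  have h1 := congrArg (fun μ => μ ({historyOf π n} ×ˢ {π (n + 1)})) key
  beta_reduce at h1
  have hs : MeasurableSet ({historyOf π n} : Set (History V n)) := (Set.toFinite _).measurableSet
  rw [hmap, Measure.compProd_apply_prod hs (measurableSet_singleton _),
    Measure.map_apply (by fun_prop) (hs.prod (measurableSet_singleton _)),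
    lintegral_singleton, Measure.map_apply (measurable_historyOf n) hs] at h1
  have h2 : stepKernel σ τ n (historyOf π n) {π (n + 1)} =
      nextDist σ τ (historyOf π n) (π (n + 1)) :=
    PMF.toMeasure_apply_singleton _ _ (measurableSet_singleton _)
  rw [h2] at h1
  refine Eq.trans ?_ h1.symm
  unfold outcomeMeasure
  congr 1
  ext ρ
  simp only [cylinder, Set.mem_ofPred_eq, Set.mem_preimage, Set.mem_prod, Set.mem_singleton_iff]
  constructor
  · exact fun h => ⟨historyOf_eq_of_le h (Nat.le_succ n), apply_eq_of_historyOf_eq h le_rfl⟩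
  · rintro ⟨h, h'⟩
    refine historyOf_eq_iff.2 fun k hk => ?_
    rcases Nat.le_succ_iff.1 hk with hk | rfl
    · exact apply_eq_of_historyOf_eq h hk
    · exact h'

/-- A lower bound for the conditional measures of `S` on all cylinders at time `n` is a lower bound
for the conditional measure on every event that is determined at time `n`. -/
theorem mul_measure_le_of_cylinder {μ : Measure (ℕ → V)} {c : ℝ≥0∞} {n : ℕ} {A S : Set (ℕ → V)}
    (hA : ∀ π ρ, historyOf π n = historyOf ρ n → π ∈ A → ρ ∈ A)
    (h : ∀ π, c * μ (cylinder π n) ≤ μ (cylinder π n ∩ S)) : c * μ A ≤ μ (A ∩ S) := by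
  classical
  let f : (ℕ → V) → History V n := fun π => historyOf π n
  have hf : Measurable f := measurable_historyOf n
  let s : Finset (History V n) := (Set.toFinite (f '' A)).toFinset
  have hs : f ⁻¹' (s : Set (History V n)) = A := by
    ext π
    simp only [s, Set.Finite.coe_toFinset]
    refine ⟨?_, fun h => ⟨π, h, rfl⟩⟩
    rintro ⟨ρ, hρ, he⟩
    exact hA ρ π he hρ
  have hm : ∀ y ∈ s, MeasurableSet (f ⁻¹' {y}) := fun y _ => hf (Set.toFinite _).measurableSet
  have e1 := sum_measure_preimage_singleton (μ := μ) s hm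
  have e2 := sum_measure_preimage_singleton (μ := μ.restrict S) s hm
  rw [hs] at e1 e2
  have hAm : MeasurableSet A := measurableSet_of_historyOf n hA
  rw [Measure.restrict_apply hAm] at e2
  rw [← e1, ← e2, Finset.mul_sum]
  refine Finset.sum_le_sum fun y hy => ?_
  rw [Measure.restrict_apply (hm y hy)]
  obtain ⟨π, -, rfl⟩ := (Set.Finite.mem_toFinset _).1 hy
  exact h π

/-- Strategies need to follow edges only after genuine paths, so the path property is carried along
by induction. -/
theorem isPrefix_of_cylinder_ne_zero {σ : G.Strategy Player.main}
    {τ : G.Strategy Player.adversary} {v : V} {π : ℕ → V} {n : ℕ}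
    (h : outcomeMeasure σ τ v (cylinder π n) ≠ 0) : G.IsPrefix (historyOf π n) := by
  induction n with
  | zero => exact fun k hk => absurd hk (Nat.not_lt_zero k)
  | succ n ih =>
    rw [outcomeMeasure_cylinder_succ] at h
    have hp := ih (right_ne_zero_of_mul h)
    intro k hk
    rcases Nat.lt_succ_iff_lt_or_eq.1 hk with hk' | rfl
    · exact hp k hk'
    · exact edge_of_nextDist_ne_zero hp (left_ne_zero_of_mul h)

theorem ae_mem_plays (σ : G.Strategy Player.main) (τ : G.Strategy Player.adversary) (v : V) :
    ∀ᵐ π ∂outcomeMeasure σ τ v, π ∈ G.plays := by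
  have h : ∀ n, ∀ᵐ π ∂outcomeMeasure σ τ v, outcomeMeasure σ τ v (cylinder π n) ≠ 0 := by
    intro n
    have hA : ∀ π ρ : ℕ → V, historyOf π n = historyOf ρ n →
        outcomeMeasure σ τ v (cylinder π n) = 0 → outcomeMeasure σ τ v (cylinder ρ n) = 0 := by
      intro π ρ h
      simp only [cylinder, h, imp_self]
    -- With `c = 1` and `S` the complement of `A`, the bound reads `μ A ≤ μ ∅`.
    have := mul_measure_le_of_cylinder (μ := outcomeMeasure σ τ v) (c := 1) (n := n)
      (A := {π | outcomeMeasure σ τ v (cylinder π n) = 0})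
      (S := {π | outcomeMeasure σ τ v (cylinder π n) ≠ 0}) hA (by
        intro π
        by_cases hπ : outcomeMeasure σ τ v (cylinder π n) = 0
        · simp [hπ]
        · rw [one_mul]
          refine measure_mono fun ρ hρ => ⟨hρ, ?_⟩
          exact fun hc => hπ (hA ρ π hρ hc))
    rw [ae_iff]
    have hemp : {π | outcomeMeasure σ τ v (cylinder π n) = 0} ∩
      {π | outcomeMeasure σ τ v (cylinder π n) ≠ 0} = ∅ := by
      ext π; simp
    rw [hemp, one_mul, measure_empty] at this
    simpa using this
  filter_upwards [ae_all_iff.2 h] with π hπ i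
  exact isPrefix_of_cylinder_ne_zero (hπ (i + 1)) i (Nat.lt_succ_self i)

end Cylinders

/-! ### Restarting strategies at prescribed times -/

section Restart

variable {V : Type*}

/-- The sequence `vₜ … vₙ`, for `t ≤ n`. -/
def History.drop {n : ℕ} (h : History V n) (t : ℕ) (ht : t ≤ n) : History V (n - t) :=
  fun k => h.get (t + k) (by have := Finset.mem_Iic.1 k.2; omega)

theorem History.last_drop {n : ℕ} (h : History V n) (t : ℕ) (ht : t ≤ n) :
    (h.drop t ht).last = h.last := by
  simp only [drop, last, get, Nat.add_sub_cancel' ht]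

variable {G : StochasticGame V}

theorem IsPrefix.drop {n : ℕ} {h : History V n} (hh : G.IsPrefix h) (t : ℕ) (ht : t ≤ n) :
    G.IsPrefix (h.drop t ht) :=
  fun k hk => hh (t + k) (by omega)

theorem adversarial_owner_eq_adversary_iff {v : V} :
    G.adversarial.owner v = Owner.player Player.adversary ↔
      G.owner v ≠ Owner.player Player.main := by
  simp only [adversarial]
  generalize G.owner v = o
  rcases o with (_ | _) | _ <;> simp

/-- The strategy of the adversary that, at time `n`, plays as the strategy `τ v` of the adversarial
game started at time `start n`, where `v` is the vertex at that time. -/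
def restart (τ : V → G.adversarial.Strategy Player.adversary) (start : ℕ → ℕ)
    (hs : ∀ n, start n ≤ n) : G.Strategy Player.adversary where
  next n h := (τ (h.get (start n) (hs n))).next (n - start n) (h.drop (start n) (hs n))
  edge_next n h hh ho := by
    have hl := h.last_drop (start n) (hs n)
    have := (τ (h.get (start n) (hs n))).edge_next _ (h.drop (start n) (hs n))
      (hh.drop (start n) (hs n)) (by
        rw [hl, adversarial_owner_eq_adversary_iff, ho]
        simp)
    rwa [hl] at this

theorem restart_next {τ : V → G.adversarial.Strategy Player.adversary} {start : ℕ → ℕ}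
    {hs : ∀ n, start n ≤ n} {t m : ℕ} (ht : start (t + m) = t) (π : ℕ → V) :
    (restart τ start hs).next (t + m) (historyOf π (t + m)) =
      (τ (π t)).next m (historyOf (suffixOf π t) m) := by
  -- The type of the dropped history depends on the start time, so that time becomes a variable
  -- before substitution.
  have h : ∀ (a b : ℕ) (ha : a ≤ t + m), a = t → b = m → t + m - a = b →
      (τ ((historyOf π (t + m)).get a ha)).next (t + m - a) ((historyOf π (t + m)).drop a ha) =
        (τ (π t)).next m (historyOf (suffixOf π t) m) := by
    rintro a b ha rfl rfl hb
    have h' : ∀ c, c = b → (τ (π a)).next c (historyOf (suffixOf π a) c) =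
        (τ (π a)).next b (historyOf (suffixOf π a) b) := by rintro c rfl; rfl
    exact h' _ hb
  exact h (start (t + m)) m (hs _) ht rfl (by omega)

open Classical in
/-- The largest element of the range of `T` that is at most `n`, or `0` if there is none. -/
noncomputable def lastTime (T : ℕ → ℕ) (n : ℕ) : ℕ :=
  Nat.findGreatest (fun t => t ∈ Set.range T) n

theorem lastTime_le (T : ℕ → ℕ) (n : ℕ) : lastTime T n ≤ n := by
  classical exact Nat.findGreatest_le n

theorem lastTime_eq {T : ℕ → ℕ} (hT : StrictMono T) {k n : ℕ} (h : T k ≤ n) (h' : n < T (k + 1)) :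
    lastTime T n = T k := by
  classical
  unfold lastTime
  rw [Nat.findGreatest_eq_iff]
  refine ⟨h, fun _ => ⟨k, rfl⟩, ?_⟩
  rintro _ hlt hle ⟨j, rfl⟩
  have h1 := hT.lt_iff_lt.1 hlt
  have h2 := hT.lt_iff_lt.1 (hle.trans_lt h')
  omega

end Restart

/-! ### From sure to almost-sure winning -/

section AlmostSure

variable {V : Type*} {G : StochasticGame V}

theorem exists_le_prob [Finite V] (G : StochasticGame V) :
    ∃ p : ℝ≥0∞, p ≠ 0 ∧ p ≤ 1 ∧ ∀ v w, G.edge v.1 w → p ≤ G.prob v w := by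
  -- The extra 1 gives `p ≤ 1` and a minimum even without probabilistic vertices.
  let s : Set ℝ≥0∞ := insert 1 ((fun x : {v : V // G.owner v = Owner.random} × V =>
    G.prob x.1 x.2) '' {x | G.edge x.1.1 x.2})
  obtain ⟨p, hp, hmin⟩ := Set.exists_min_image s id ((Set.toFinite _).insert 1)
    (Set.insert_nonempty _ _)
  refine ⟨p, ?_, hmin 1 (Set.mem_insert _ _), fun v w h =>
    hmin _ (Set.mem_insert_of_mem _ ⟨(v, w), h, rfl⟩)⟩
  rcases hp with rfl | ⟨⟨v, w⟩, h, rfl⟩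
  · exact one_ne_zero
  · exact (PMF.mem_support_iff _ _).1 ((G.mem_support_prob v w).2 h)

theorem exists_uniform_not_mem_noOpenWindow [Finite V]
    {τ : V → G.adversarial.Strategy Player.adversary}
    (hτ : ∀ v, ∀ π ∈ G.adversarial.plays, π 0 = v → (τ v).Consistent π →
      π ∈ G.adversarial.compl G.adversarial.BWMP) {ℓ : ℕ} (hℓ : 1 ≤ ℓ) :
    ∃ N, ∀ π : ℕ → V, (τ (π 0)).ConsistentUpTo N π → π ∉ G.NoOpenWindow ℓ 0 N := by
  choose N hN using fun v => exists_not_mem_noOpenWindow (hτ v) hℓ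
  obtain ⟨M, hM⟩ := (Set.finite_range N).bddAbove
  refine ⟨M, fun π hπ hno => ?_⟩
  have hle : N (π 0) ≤ M := hM ⟨π 0, rfl⟩
  exact hN (π 0) π rfl (fun j hj => hπ j (hj.trans_le hle)) (noOpenWindow_anti hle hno)

variable {σ : G.Strategy Player.main} {τ : G.Strategy Player.adversary}

/-- Player 1's own move never breaks consistency with `τ'`; the adversary already copies `τ'`; at a
probabilistic vertex the choice of `τ'` has probability at least `p`. -/
theorem exists_le_nextDist {p : ℝ≥0∞} (hp1 : p ≤ 1)
    (hp : ∀ v w, G.edge v.1 w → p ≤ G.prob v w) {τ' : G.adversarial.Strategy Player.adversary}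
    {T m : ℕ} {ρ : ℕ → V} (hpre : G.IsPrefix (historyOf ρ (T + m)))
    (hτ : τ.next (T + m) (historyOf ρ (T + m)) = τ'.next m (historyOf (suffixOf ρ T) m)) :
    ∃ w, p ≤ nextDist σ τ (historyOf ρ (T + m)) w ∧ G.edge (ρ (T + m)) w ∧
      (G.adversarial.owner (ρ (T + m)) = Owner.player Player.adversary →
        w = τ'.next m (historyOf (suffixOf ρ T) m)) := by
  rw [adversarial_owner_eq_adversary_iff]
  unfold nextDist
  split
  · rename_i ho
    refine ⟨_, ?_, σ.edge_next _ _ hpre ho, fun hc => absurd ho hc⟩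
    simpa using hp1
  · rename_i ho
    refine ⟨_, ?_, τ.edge_next _ _ hpre ho, fun _ => hτ⟩
    simpa using hp1
  · rename_i ho
    have ho' : G.owner (ρ (T + m)) = Owner.random := ho
    have he : G.edge (ρ (T + m)) (τ'.next m (historyOf (suffixOf ρ T) m)) :=
      τ'.edge_next m (historyOf (suffixOf ρ T) m) (fun k hk => hpre (T + k) (by omega))
        (adversarial_owner_eq_adversary_iff.2 (by
          change G.owner (ρ (T + m)) ≠ _
          simp [ho']))
    exact ⟨_, hp ⟨_, ho⟩ _ he, he, fun _ => rfl⟩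

variable [Finite V] [MeasurableSpace V] [DiscreteMeasurableSpace V] {v : V}

/-- A single path suffices: each step supplies one successor of conditional probability at least `p`
that agrees with `τ'`. -/
theorem exists_consistent_extension {p : ℝ≥0∞} (hp0 : p ≠ 0) (hp1 : p ≤ 1)
    (hp : ∀ v w, G.edge v.1 w → p ≤ G.prob v w) {τ' : G.adversarial.Strategy Player.adversary}
    {T N : ℕ} {π : ℕ → V}
    (hτ : ∀ m < N, ∀ ρ : ℕ → V, ρ T = π T →
      τ.next (T + m) (historyOf ρ (T + m)) = τ'.next m (historyOf (suffixOf ρ T) m))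
    (h0 : outcomeMeasure σ τ v (cylinder π T) ≠ 0) {m : ℕ} (hm : m ≤ N) :
    ∃ ρ : ℕ → V, historyOf ρ T = historyOf π T ∧
      p ^ m * outcomeMeasure σ τ v (cylinder π T) ≤ outcomeMeasure σ τ v (cylinder ρ (T + m)) ∧
      τ'.ConsistentUpTo m (suffixOf ρ T) := by
  induction m with
  | zero => exact ⟨π, rfl, by simp, fun j hj => absurd hj (Nat.not_lt_zero j)⟩
  | succ m ih =>
    obtain ⟨ρ, hρT, hρ, hc⟩ := ih (by omega)
    have hpos : outcomeMeasure σ τ v (cylinder ρ (T + m)) ≠ 0 := fun h => by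
      rw [h, nonpos_iff_eq_zero, mul_eq_zero] at hρ
      exact hρ.elim (pow_ne_zero _ hp0) h0
    obtain ⟨w, hw, he, ho⟩ := exists_le_nextDist (σ := σ) hp1 hp
      (isPrefix_of_cylinder_ne_zero hpos)
      (hτ m (by omega) ρ (apply_eq_of_historyOf_eq hρT le_rfl))
    have hup : historyOf (Function.update ρ (T + m + 1) w) (T + m) = historyOf ρ (T + m) :=
      historyOf_eq_iff.2 fun k hk => Function.update_of_ne (by omega) _ _
    have hlast : Function.update ρ (T + m + 1) w (T + m + 1) = w := Function.update_self ..
    have hsuf : historyOf (suffixOf (Function.update ρ (T + m + 1) w) T) m =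
        historyOf (suffixOf ρ T) m :=
      historyOf_eq_iff.2 fun k hk => Function.update_of_ne (by omega) _ _
    refine ⟨Function.update ρ (T + m + 1) w,
      (historyOf_eq_of_le hup (Nat.le_add_right T m)).trans hρT, ?_, ?_⟩
    · rw [← add_assoc, outcomeMeasure_cylinder_succ, hup, hlast, pow_succ', mul_assoc]
      refine mul_le_mul' hw (hρ.trans_eq ?_)
      simp only [cylinder, hup]
    · intro j hj
      rcases Nat.lt_succ_iff_lt_or_eq.1 hj with hj | rfl
      · exact hc.congr hsuf.symm j hj
      · have h1 : suffixOf (Function.update ρ (T + j + 1) w) T j = ρ (T + j) :=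
          apply_eq_of_historyOf_eq hup le_rfl
        have h2 : suffixOf (Function.update ρ (T + j + 1) w) T (j + 1) = w := hlast
        rw [h1, h2, hsuf]
        exact ⟨he, ho⟩

/-- After each history at time `T`, the consistent extension contains an open window, which starts
at or after `K` because `K ≤ T`. -/
theorem mul_measure_le_of_restart {p : ℝ≥0∞} (hp0 : p ≠ 0) (hp1 : p ≤ 1)
    (hp : ∀ v w, G.edge v.1 w → p ≤ G.prob v w)
    {τ' : V → G.adversarial.Strategy Player.adversary} {ℓ K T N : ℕ} (hK : K ≤ T)
    (hN : ∀ π : ℕ → V, (τ' (π 0)).ConsistentUpTo N π → π ∉ G.NoOpenWindow ℓ 0 N)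
    (hτ : ∀ m < N, ∀ ρ : ℕ → V,
      τ.next (T + m) (historyOf ρ (T + m)) = (τ' (ρ T)).next m (historyOf (suffixOf ρ T) m)) :
    p ^ N * outcomeMeasure σ τ v (G.NoOpenWindow ℓ K T) ≤
      outcomeMeasure σ τ v (G.NoOpenWindow ℓ K T ∩ (G.NoOpenWindow ℓ K (T + N))ᶜ) := by
  refine mul_measure_le_of_cylinder (n := T) (fun π ρ h => (mem_noOpenWindow_congr h).1)
    fun π => ?_
  by_cases h0 : outcomeMeasure σ τ v (cylinder π T) = 0
  · simp [h0]
  obtain ⟨ρ, hρT, hρ, hc⟩ := exists_consistent_extension hp0 hp1 hp (τ' := τ' (π T)) (N := N)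
    (fun m hm ρ h => by rw [hτ m hm ρ, h]) h0 le_rfl
  refine hρ.trans (measure_mono fun π' hπ' => ?_)
  have hπ'' : historyOf π' (T + N) = historyOf ρ (T + N) := hπ'
  refine ⟨(historyOf_eq_of_le hπ'' (Nat.le_add_right T N)).trans hρT, fun hno => ?_⟩
  have hno' := (mem_noOpenWindow_congr hπ'').1 hno
  have h00 : suffixOf ρ T 0 = π T := apply_eq_of_historyOf_eq hρT le_rfl
  refine hN (suffixOf ρ T) (h00 ▸ hc) fun i _ hi ho => ?_
  exact hno' (T + i) (by omega) (by omega) (openWindow_suffixOf.1 ho)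

/-- Let `b` be the limiting probability of no open window. Each good `T` splits its event into a
part of measure at least `b` and a lost part of at least `c * b`; if `b > 0`, this contradicts
convergence to `b`. -/
theorem ae_exists_not_mem_noOpenWindow {ℓ K : ℕ} {c : ℝ≥0∞} (hc : c ≠ 0)
    (h : ∀ n, ∃ T ≥ n, ∃ T', c * outcomeMeasure σ τ v (G.NoOpenWindow ℓ K T) ≤
      outcomeMeasure σ τ v (G.NoOpenWindow ℓ K T ∩ (G.NoOpenWindow ℓ K T')ᶜ)) :
    ∀ᵐ π ∂outcomeMeasure σ τ v, ∃ n, π ∉ G.NoOpenWindow ℓ K n := by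
  set μ := outcomeMeasure σ τ v
  set b := μ (⋂ n, G.NoOpenWindow ℓ K n) with hb
  have hset : {π | ¬ ∃ n, π ∉ G.NoOpenWindow ℓ K n} = ⋂ n, G.NoOpenWindow ℓ K n := by
    ext π; simp
  rw [ae_iff, hset, ← hb]
  by_contra hb0
  have hbt : b ≠ ∞ := measure_ne_top _ _
  have hlim := tendsto_measure_iInter_atTop (μ := μ)
    (fun n => (G.measurableSet_noOpenWindow ℓ K n).nullMeasurableSet)
    (fun m n hmn => noOpenWindow_anti hmn) ⟨0, measure_ne_top _ _⟩
  have hlt : b < b + c * b := ENNReal.lt_add_right hbt (mul_ne_zero hc hb0)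
  obtain ⟨n, hn⟩ := Filter.eventually_atTop.1 (hlim.eventually_lt_const hlt)
  obtain ⟨T, hT, T', hTT'⟩ := h n
  refine absurd (hn T hT) (not_lt.2 ?_)
  rw [Function.comp_apply,
    ← measure_inter_add_sdiff (G.NoOpenWindow ℓ K T) (G.measurableSet_noOpenWindow ℓ K T')]
  have hle : ∀ m, b ≤ μ (G.NoOpenWindow ℓ K m) := fun m => measure_mono (Set.iInter_subset _ m)
  refine add_le_add ?_ ?_
  · exact measure_mono (Set.subset_inter (Set.iInter_subset _ T) (Set.iInter_subset _ T'))
  · rw [Set.sdiff_eq]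
    exact (mul_le_mul' le_rfl (hle T)).trans hTT'

theorem exists_strategy_ae_mem_compl_BWMP
    {τ' : V → G.adversarial.Strategy Player.adversary}
    (hτ' : ∀ v, ∀ π ∈ G.adversarial.plays, π 0 = v → (τ' v).Consistent π →
      π ∈ G.adversarial.compl G.adversarial.BWMP) :
    ∃ τ : G.Strategy Player.adversary, ∀ (σ : G.Strategy Player.main) (v : V),
      ∀ᵐ π ∂outcomeMeasure σ τ v, π ∈ G.compl G.BWMP := by
  obtain ⟨p, hp0, hp1, hp⟩ := G.exists_le_prob
  choose! N hN using fun (ℓ : ℕ) (hℓ : 1 ≤ ℓ) => exists_uniform_not_mem_noOpenWindow hτ' hℓ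
  -- Unpairing the phase index makes each `ℓ` recur infinitely often; the `+ 1` keeps `T` strictly
  -- increasing whatever `N` is.
  let T : ℕ → ℕ := fun k => ∑ i ∈ Finset.range k, (N i.unpair.1 + 1)
  have hsucc : ∀ k, T (k + 1) = T k + (N k.unpair.1 + 1) := fun k => Finset.sum_range_succ _ k
  have hT : StrictMono T := strictMono_nat_of_lt_succ fun k => by rw [hsucc]; omega
  refine ⟨restart τ' (lastTime T) (lastTime_le T), fun σ v => ?_⟩
  have h : ∀ ℓ ≥ 1, ∀ K, ∀ᵐ π ∂outcomeMeasure σ (restart τ' (lastTime T) (lastTime_le T)) v,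
      ∃ n, π ∉ G.NoOpenWindow ℓ K n := by
    intro ℓ hℓ K
    refine ae_exists_not_mem_noOpenWindow (pow_ne_zero (N ℓ) hp0) fun n => ?_
    -- A phase devoted to `ℓ` that begins after both `n` and `K`, since `T k ≥ k ≥ max n K`.
    let k := Nat.pair ℓ (max n K)
    have hk : max n K ≤ T k := (Nat.right_le_pair _ _).trans (hT.id_le k)
    refine ⟨T k, (le_max_left _ _).trans hk, T k + N ℓ,
      mul_measure_le_of_restart hp0 hp1 hp ((le_max_right _ _).trans hk) (hN ℓ hℓ) ?_⟩
    intro m hm ρ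
    refine restart_next (lastTime_eq hT (Nat.le_add_right _ _) ?_) ρ
    rw [hsucc, Nat.unpair_pair]
    simp only
    omega
  have h' := ae_all_iff.2 fun ℓ => ae_all_iff.2 fun hℓ => ae_all_iff.2 (h ℓ hℓ)
  filter_upwards [h', ae_mem_plays σ _ v] with π hπ hplay
  exact mem_compl_BWMP_iff.2 ⟨hplay, hπ⟩

end AlmostSure

end StochasticGame

theorem mainTheorem5 {V : Type*} [Finite V] [MeasurableSpace V] [DiscreteMeasurableSpace V]
    (G : StochasticGame V) : G.SAS G.BWMP := by
  refine ⟨⟨fun π h => h.1, G.measurableSet_BWMP⟩, StochasticGame.prefixIndependent_BWMP, ?_⟩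
  intro hsure
  choose τ' hτ' using fun v => Set.eq_univ_iff_forall.1 hsure v
  obtain ⟨τ, hτ⟩ := StochasticGame.exists_strategy_ae_mem_compl_BWMP hτ'
  refine Set.eq_univ_iff_forall.2 fun v => ⟨τ, fun σ => ?_⟩
  exact (prob_compl_eq_zero_iff (G.measurableSet_plays.diff G.measurableSet_BWMP)).1 (hτ σ v)
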